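/- Let $d \ge 0$ be an integer. A Hilbert space with a $d$-dimensional coordinate system is a pair $(\mathcal H, E)$ of a complex Hilbert space $\mathcal H$ and a spectral measure $E$ on $\mathbb R^d$, i.e. a map from the Borel subsets of $\mathbb R^d$ to the orthogonal projections on $\mathcal H$ that is countably additive in the strong operator topology and satisfies $E(\mathbb R^d) = 1$. Put $v_E(k) = \int_{\mathbb R^d} e^{i x \cdot k}\, dE(x)$ for $k \in \mathbb R^d$. Let $(\mathcal H_1, E_1)$, $(\mathcal H_2, E_2)$ be Hilbert spaces with $d$-dimensional coordinate systems, let $W \colon \mathcal H_1 \to \mathcal H_2$ be a bounded linear operator, and put $W_k = v_{E_2}(k)\, W\, v_{E_1}(-k)$ for $k \in \mathbb R^d$, an element of the Banach space $\mathcal B(\mathcal H_1, \mathcal H_2)$ with the operator norm. Say that $W$ - has finite propagation if there is a constant $R \ge 0$ such that $E_2(A_2)\, W\, E_1(A_1) = 0$ for all Borel sets $A_1, A_2 \subset \mathbb R^d$ with $\mathrm{dist}(A_1, A_2) > R$, where $\mathrm{dist}(A_1,A_2) = \inf\{|x-y| : x \in A_1, y \in A_2\}$ (Euclidean distance); - is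 analytic if $k \mapsto W_k$ extends to a holomorphic map from a domain (connected open set) in $\mathbb C^d$ containing $\mathbb R^d$ to $\mathcal B(\mathcal H_1, \mathcal H_2)$; - is smooth if $k \mapsto W_k$ is a $C^\infty$ map $\mathbb R^d \to \mathcal B(\mathcal H_1, \mathcal H_2)$; - is uniform if $k \mapsto W_k$ is continuous with respect to the operator norm. Theorem. 1. If $W$ has finite propagation, then $W$ is analytic; moreover $k \mapsto W_k$ extends to a holomorphic map on all of $\mathbb C^d$. 2. If $W$ is analytic, then $W$ is smooth. 3. If $W$ is smooth, then $W$ is uniform. -/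

import Mathlib

open MeasureTheory Set Filter Topology
open scoped ENNReal NNReal ContDiff

noncomputable section

/-- A spectral measure (projection-valued measure) on a measurable space `X`, acting on a complex
Hilbert space `H`: every measurable set is mapped to an orthogonal projection, the whole space is
mapped to the identity, and the map is countably additive in the strong operator topology.
Values on non-measurable sets are irrelevant. -/
structure SpectralMeasure (X : Type*) [MeasurableSpace X] (H : Type*) [NormedAddCommGroup H]
    [InnerProductSpace ℂ H] [CompleteSpace H] where
  /-- The projection attached to a set. -/
  proj : Set X → H →L[ℂ] H
  isStarProjection_proj : ∀ A, MeasurableSet A → IsStarProjection (proj A)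
  proj_univ : proj Set.univ = ContinuousLinearMap.id ℂ H
  hasSum_proj : ∀ A : ℕ → Set X, (∀ n, MeasurableSet (A n)) →
    Pairwise (fun m n => Disjoint (A m) (A n)) →
    ∀ ξ : H, HasSum (fun n => proj (A n) ξ) (proj (⋃ n, A n) ξ)

namespace SpectralMeasure

variable {X : Type*} [MeasurableSpace X] {H : Type*} [NormedAddCommGroup H]
  [InnerProductSpace ℂ H] [CompleteSpace H]

theorem proj_empty_apply (E : SpectralMeasure X H) (ξ : H) : E.proj ∅ ξ = 0 := by
  have h := E.hasSum_proj (fun _ => ∅) (fun _ => MeasurableSet.empty)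
    (fun _ _ _ => disjoint_bot_left) ξ
  exact tendsto_nhds_unique tendsto_const_nhds h.summable.tendsto_atTop_zero

theorem inner_proj (E : SpectralMeasure X H) {A : Set X} (hA : MeasurableSet A) (ξ : H) :
    inner ℂ ξ (E.proj A ξ) = ((‖E.proj A ξ‖ ^ 2 : ℝ) : ℂ) := by
  have hp := E.isStarProjection_proj A hA
  have h1 : E.proj A (E.proj A ξ) = E.proj A ξ := by
    have := congrArg (fun T : H →L[ℂ] H => T ξ) hp.isIdempotentElem.eq
    simpa using this
  have h2 : ContinuousLinearMap.adjoint (E.proj A) = E.proj A := hp.isSelfAdjoint.star_eq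
  have h3 : inner ℂ ξ (E.proj A (E.proj A ξ)) = inner ℂ (E.proj A ξ) (E.proj A ξ) := by
    rw [← ContinuousLinearMap.adjoint_inner_left, h2]
  rw [h1, inner_self_eq_norm_sq_to_K] at h3
  rw [h3]; norm_cast

/-- The positive measure `A ↦ ⟨E(A) ξ, ξ⟩` attached to a vector `ξ`. -/
def diagMeasure (E : SpectralMeasure X H) (ξ : H) : Measure X :=
  Measure.ofMeasurable (fun A _ => ENNReal.ofReal (inner ℂ ξ (E.proj A ξ)).re)
    (by simp [E.proj_empty_apply])
    (by
      intro A hA hd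
      have hs := E.hasSum_proj A hA hd ξ
      have hs' : HasSum (fun n => (inner ℂ ξ (E.proj (A n) ξ)).re)
          (inner ℂ ξ (E.proj (⋃ n, A n) ξ)).re :=
        Complex.hasSum_re ((innerSL ℂ ξ).hasSum hs)
      rw [← hs'.tsum_eq, ENNReal.ofReal_tsum_of_nonneg _ hs'.summable]
      intro n
      rw [E.inner_proj (hA n), Complex.ofReal_re]
      positivity)

theorem diagMeasure_apply (E : SpectralMeasure X H) (ξ : H) {A : Set X} (hA : MeasurableSet A) :
    E.diagMeasure ξ A = ENNReal.ofReal (inner ℂ ξ (E.proj A ξ)).re :=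
  Measure.ofMeasurable_apply A hA

theorem diagMeasure_univ (E : SpectralMeasure X H) (ξ : H) :
    E.diagMeasure ξ Set.univ = ENNReal.ofReal (‖ξ‖ ^ 2) := by
  rw [diagMeasure_apply E ξ MeasurableSet.univ, E.inner_proj MeasurableSet.univ, E.proj_univ]
  rfl

instance (E : SpectralMeasure X H) (ξ : H) : IsFiniteMeasure (E.diagMeasure ξ) :=
  ⟨by rw [diagMeasure_univ]; exact ENNReal.ofReal_lt_top⟩

/-- `T = ∫ f dE`, in the usual weak sense: `⟨T ξ, ξ⟩ = ∫ f dμ_ξ` for every vector `ξ`, where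
`μ_ξ(A) = ⟨E(A) ξ, ξ⟩`. -/
def HasIntegral (E : SpectralMeasure X H) (f : X → ℂ) (T : H →L[ℂ] H) : Prop :=
  ∀ ξ : H, inner ℂ ξ (T ξ) = ∫ x, f x ∂(E.diagMeasure ξ)

/-- An operator integral is determined by its defining property. -/
theorem HasIntegral.unique {E : SpectralMeasure X H} {f : X → ℂ} {S T : H →L[ℂ] H}
    (hS : E.HasIntegral f S) (hT : E.HasIntegral f T) : S = T := by
  have h : (S : H →ₗ[ℂ] H) = (T : H →ₗ[ℂ] H) := by
    rw [← ext_inner_map]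
    intro ξ
    rw [← inner_conj_symm, ← inner_conj_symm (T.toLinearMap ξ)]
    exact congrArg _ ((hS ξ).trans (hT ξ).symm)
  exact ContinuousLinearMap.coe_injective h

theorem norm_le_of_inner_le {H : Type*} [NormedAddCommGroup H] [InnerProductSpace ℂ H]
    {T : H →L[ℂ] H} {M : ℝ} (hM : 0 ≤ M)
    (h : ∀ ξ, ‖inner ℂ ξ (T ξ)‖ ≤ M * ‖ξ‖ ^ 2) : ‖T‖ ≤ 2 * M := by
  have key : ∀ x y : H, ‖x‖ = 1 → ‖y‖ = 1 → ‖inner ℂ (T y) x‖ ≤ 2 * M := by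
    intro x y hx hy
    have h' : ∀ ξ, ‖inner ℂ (T ξ) ξ‖ ≤ M * ‖ξ‖ ^ 2 := fun ξ => by
      rw [← inner_conj_symm, RCLike.norm_conj]; exact h ξ
    have e := inner_map_polarization (T : H →ₗ[ℂ] H) x y
    simp only [ContinuousLinearMap.coe_coe] at e
    rw [e, norm_div]
    have p1 := parallelogram_law_with_norm ℂ x y
    have p2 := parallelogram_law_with_norm ℂ x (Complex.I • y)
    have n2 : ‖Complex.I • y‖ = 1 := by rw [norm_smul, Complex.norm_I, hy, one_mul]
    rw [hx, hy] at p1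
    rw [hx, n2] at p2
    have b1 := h' (x + y)
    have b2 := h' (x - y)
    have b3 := h' (x + Complex.I • y)
    have b4 := h' (x - Complex.I • y)
    have n3 : ∀ z : ℂ, ‖Complex.I * z‖ = ‖z‖ := fun z => by simp
    have n4 : ‖(4 : ℂ)‖ = 4 := by simp
    rw [n4, div_le_iff₀ (by norm_num)]
    refine (norm_sub_le _ _).trans ?_
    refine (add_le_add (norm_add_le _ _) le_rfl).trans ?_
    refine (add_le_add (add_le_add (norm_sub_le _ _) le_rfl) le_rfl).trans ?_
    rw [n3, n3]
    nlinarith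
  refine T.opNorm_le_of_unit_norm (by positivity) ?_
  intro y hy
  by_cases h0 : T y = 0
  · rw [h0, norm_zero]; positivity
  have hn : ‖T y‖ ≠ 0 := norm_ne_zero_iff.mpr h0
  have := key (((‖T y‖⁻¹ : ℝ) : ℂ) • T y) y (by
    rw [norm_smul, Complex.norm_real, norm_inv, norm_norm, inv_mul_cancel₀ hn]) hy
  rw [inner_smul_right, inner_self_eq_norm_sq_to_K, norm_mul, Complex.norm_real, norm_inv,
    norm_norm, norm_pow] at this
  simpa [pow_two, ← mul_assoc, hn] using this

theorem hasIntegral_simpleFunc (E : SpectralMeasure X H) (s : SimpleFunc X ℂ) :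
    E.HasIntegral s (∑ y ∈ s.range, y • E.proj (s ⁻¹' {y})) := by
  intro ξ
  rw [← SimpleFunc.integral_eq_integral s (SimpleFunc.integrable_of_isFiniteMeasure s),
    SimpleFunc.integral_eq, sum_apply, inner_sum]
  refine Finset.sum_congr rfl fun y _ => ?_
  have hm := s.measurableSet_fiber y
  rw [smul_apply, inner_smul_right, Measure.real, diagMeasure_apply E ξ hm,
    E.inner_proj hm, Complex.ofReal_re, ENNReal.toReal_ofReal (by positivity), mul_comm,
    Complex.real_smul]

theorem exists_simpleFunc_near {f : X → ℂ} (hf : Measurable f) {C : ℝ} (hC : ∀ x, ‖f x‖ ≤ C)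
    {ε : ℝ} (hε : 0 < ε) : ∃ s : SimpleFunc X ℂ, ∀ x, ‖s x - f x‖ ≤ ε := by
  have hcov : Metric.closedBall (0 : ℂ) C ⊆
      ⋃ k, Metric.ball (TopologicalSpace.denseSeq ℂ k) ε := by
    intro z _
    obtain ⟨k, hk⟩ := (TopologicalSpace.denseRange_denseSeq ℂ).exists_dist_lt z hε
    exact mem_iUnion.mpr ⟨k, hk⟩
  obtain ⟨t, ht⟩ := (isCompact_closedBall (0 : ℂ) C).elim_finite_subcover _
    (fun _ => Metric.isOpen_ball) hcov
  refine ⟨(SimpleFunc.nearestPt (TopologicalSpace.denseSeq ℂ) (t.sup id)).comp f hf, fun x => ?_⟩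
  have hx : f x ∈ Metric.closedBall (0 : ℂ) C := by simpa using hC x
  obtain ⟨k, hk, hxk⟩ := mem_iUnion₂.mp (ht hx)
  have h := SimpleFunc.edist_nearestPt_le (TopologicalSpace.denseSeq ℂ) (f x)
    (Finset.le_sup (f := id) hk)
  rw [edist_dist, edist_dist, ENNReal.ofReal_le_ofReal_iff dist_nonneg] at h
  rw [SimpleFunc.coe_comp, Function.comp_apply, ← dist_eq_norm]
  refine h.trans ?_
  rw [dist_comm]
  exact (Metric.mem_ball.mp hxk).le

/-- Every bounded measurable function can be integrated against a spectral measure. -/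
theorem exists_hasIntegral (E : SpectralMeasure X H) {f : X → ℂ} (hf : Measurable f) {C : ℝ}
    (hC : ∀ x, ‖f x‖ ≤ C) : ∃ T, E.HasIntegral f T := by
  have hpos : ∀ n : ℕ, (0 : ℝ) < 1 / ((n : ℝ) + 1) := fun n => Nat.one_div_pos_of_nat
  choose s hs using fun n : ℕ => exists_simpleFunc_near hf hC (hpos n)
  set T : ℕ → H →L[ℂ] H := fun n => ∑ y ∈ (s n).range, y • E.proj (s n ⁻¹' {y}) with hT
  have hTi : ∀ n, E.HasIntegral (s n) (T n) := fun n => E.hasIntegral_simpleFunc (s n)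
  have hfi : ∀ ξ, Integrable f (E.diagMeasure ξ) := fun ξ =>
    Integrable.of_bound hf.aestronglyMeasurable C (Eventually.of_forall hC)
  have hsi : ∀ n ξ, Integrable (s n) (E.diagMeasure ξ) := fun n ξ =>
    SimpleFunc.integrable_of_isFiniteMeasure (s n)
  have hreal : ∀ ξ, (E.diagMeasure ξ).real Set.univ = ‖ξ‖ ^ 2 := fun ξ => by
    rw [Measure.real, diagMeasure_univ, ENNReal.toReal_ofReal (by positivity)]
  have hd : ∀ n ξ, ‖inner ℂ ξ (T n ξ) - ∫ x, f x ∂(E.diagMeasure ξ)‖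
      ≤ 1 / ((n : ℝ) + 1) * ‖ξ‖ ^ 2 := by
    intro n ξ
    rw [hTi n ξ, ← integral_sub (hsi n ξ) (hfi ξ), ← hreal ξ]
    exact norm_integral_le_of_norm_le_const (Eventually.of_forall (hs n))
  have hlim0 : Tendsto (fun n : ℕ => 1 / ((n : ℝ) + 1)) atTop (𝓝 0) :=
    tendsto_one_div_add_atTop_nhds_zero_nat
  have hcauchy : CauchySeq T := by
    refine cauchySeq_of_le_tendsto_0 (fun N : ℕ => 4 * (1 / ((N : ℝ) + 1))) ?_ ?_
    · intro n m N hn hm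
      have hn' : 1 / ((n : ℝ) + 1) ≤ 1 / ((N : ℝ) + 1) := Nat.one_div_le_one_div hn
      have hm' : 1 / ((m : ℝ) + 1) ≤ 1 / ((N : ℝ) + 1) := Nat.one_div_le_one_div hm
      have := norm_le_of_inner_le (T := T n - T m) (M := 2 * (1 / ((N : ℝ) + 1)))
        (by have := hpos N; positivity) (by
          intro ξ
          have h1 := hd n ξ
          have h2 := hd m ξ
          have e : inner ℂ ξ ((T n - T m) ξ) =
              (inner ℂ ξ (T n ξ) - ∫ x, f x ∂(E.diagMeasure ξ)) -
              (inner ℂ ξ (T m ξ) - ∫ x, f x ∂(E.diagMeasure ξ)) := by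
            rw [sub_apply, inner_sub_right]; ring
          rw [e]
          refine (norm_sub_le _ _).trans ?_
          have hsq : 0 ≤ ‖ξ‖ ^ 2 := by positivity
          nlinarith)
      rw [dist_eq_norm]
      linarith
    · simpa using hlim0.const_mul 4
  obtain ⟨S, hS⟩ := cauchySeq_tendsto_of_complete hcauchy
  refine ⟨S, fun ξ => ?_⟩
  have t1 : Tendsto (fun n => inner ℂ ξ (T n ξ)) atTop (𝓝 (inner ℂ ξ (S ξ))) :=
    tendsto_const_nhds.inner
      (((ContinuousLinearMap.apply ℂ H ξ).continuous.tendsto S).comp hS)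
  have t2 : Tendsto (fun n => inner ℂ ξ (T n ξ)) atTop
      (𝓝 (∫ x, f x ∂(E.diagMeasure ξ))) := by
    rw [tendsto_iff_norm_sub_tendsto_zero]
    refine squeeze_zero (fun _ => norm_nonneg _) (fun n => hd n ξ) ?_
    simpa using hlim0.mul_const (‖ξ‖ ^ 2)
  exact tendsto_nhds_unique t1 t2

open Classical in
/-- The operator `∫ f dE`; it has its defining property for every bounded measurable `f`,
see `hasIntegral_integral`. -/
def integral (E : SpectralMeasure X H) (f : X → ℂ) : H →L[ℂ] H :=
  if h : ∃ T, E.HasIntegral f T then h.choose else 0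

theorem hasIntegral_integral (E : SpectralMeasure X H) {f : X → ℂ} (hf : Measurable f) {C : ℝ}
    (hC : ∀ x, ‖f x‖ ≤ C) : E.HasIntegral f (E.integral f) := by
  have h := E.exists_hasIntegral hf hC
  rw [integral, dif_pos h]
  exact h.choose_spec

/-- The representation `v_E(k) = ∫ exp(i x·k) dE(x)` of `ℝᵈ` attached to a spectral measure
on `ℝᵈ`. -/
def rep {d : ℕ} (E : SpectralMeasure (EuclideanSpace ℝ (Fin d)) H)
    (k : EuclideanSpace ℝ (Fin d)) : H →L[ℂ] H :=
  E.integral fun x => Complex.exp (Complex.I * ((inner ℝ x k : ℝ) : ℂ))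

/-- The operators `v_E(k)` are genuine operator integrals. -/
theorem hasIntegral_rep {d : ℕ} (E : SpectralMeasure (EuclideanSpace ℝ (Fin d)) H)
    (k : EuclideanSpace ℝ (Fin d)) :
    E.HasIntegral (fun x => Complex.exp (Complex.I * ((inner ℝ x k : ℝ) : ℂ))) (E.rep k) :=
  E.hasIntegral_integral (C := 1) (by fun_prop) (fun x => by
    rw [mul_comm, Complex.norm_exp_ofReal_mul_I])

end SpectralMeasure

/-- The distance `inf {|x - y| : x ∈ A, y ∈ B}` of two sets, equal to `∞` if one of them is
empty. -/
def setEDist {X : Type*} [PseudoEMetricSpace X] (A B : Set X) : ℝ≥0∞ :=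
  ⨅ x ∈ A, ⨅ y ∈ B, edist x y

/-- The inclusion of `ℝᵈ` in `ℂᵈ`. -/
def complexify {d : ℕ} (k : EuclideanSpace ℝ (Fin d)) : EuclideanSpace ℂ (Fin d) :=
  WithLp.toLp 2 fun j => ((k j : ℝ) : ℂ)

section Morphisms

variable {d : ℕ} {H₁ H₂ : Type*} [NormedAddCommGroup H₁] [InnerProductSpace ℂ H₁]
  [CompleteSpace H₁] [NormedAddCommGroup H₂] [InnerProductSpace ℂ H₂] [CompleteSpace H₂]
  (E₁ : SpectralMeasure (EuclideanSpace ℝ (Fin d)) H₁)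
  (E₂ : SpectralMeasure (EuclideanSpace ℝ (Fin d)) H₂) (W : H₁ →L[ℂ] H₂)

/-- The family `W_k = v₂(k) W v₁(-k)`, `k ∈ ℝᵈ`. -/
def conjFamily (k : EuclideanSpace ℝ (Fin d)) : H₁ →L[ℂ] H₂ :=
  (E₂.rep k).comp (W.comp (E₁.rep (-k)))

/-- `W` has finite propagation: for some constant `R`, `E₂(A₂) W E₁(A₁) = 0` whenever the Borel
sets `A₁`, `A₂` have distance larger than `R`. -/
def HasFinitePropagation : Prop :=
  ∃ R : ℝ≥0, ∀ A₁ A₂ : Set (EuclideanSpace ℝ (Fin d)), MeasurableSet A₁ → MeasurableSet A₂ →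
    (R : ℝ≥0∞) < setEDist A₁ A₂ → (E₂.proj A₂).comp (W.comp (E₁.proj A₁)) = 0

/-- The family `W_k` extends to a holomorphic map on the subset `U` of `ℂᵈ`, with values in the
bounded operators with the operator norm. -/
def ExtendsHolomorphicallyTo (U : Set (EuclideanSpace ℂ (Fin d))) : Prop :=
  ∃ F : EuclideanSpace ℂ (Fin d) → (H₁ →L[ℂ] H₂), DifferentiableOn ℂ F U ∧
    ∀ k : EuclideanSpace ℝ (Fin d), F (complexify k) = conjFamily E₁ E₂ W k

/-- `W` is analytic: `W_k` extends holomorphically to a domain (a connected open set) in `ℂᵈ`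
that contains `ℝᵈ`. -/
def IsAnalyticMorphism : Prop :=
  ∃ U : Set (EuclideanSpace ℂ (Fin d)), IsOpen U ∧ IsConnected U ∧
    Set.range (complexify (d := d)) ⊆ U ∧ ExtendsHolomorphicallyTo E₁ E₂ W U

/-- `W` is smooth: `k ↦ W_k` is a `C^∞` map into the bounded operators. -/
def IsSmoothMorphism : Prop :=
  ContDiff ℝ ∞ (conjFamily E₁ E₂ W)

/-- `W` is uniform: `k ↦ W_k` is continuous for the operator norm. -/
def IsUniformMorphism : Prop :=
  Continuous (conjFamily E₁ E₂ W)

end Morphisms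

end

/-! Write each coordinate vector as `x = ⌊x⌋ + {x}` and split `v_E(k)` accordingly into two
commuting factors. The fractional part is bounded, so its factor is the exponential of a bounded
operator linear in `k` and is entire in operator norm (`differentiable_fractExp`). The integer
factors conjugate `W` to an operator `V_k` whose block between the unit cells of `n` and `m` is `exp
(i k·(m - n))` times the block of `W` (`proj_comp_latticeRep_conj_comp_proj`). Finite propagation
leaves only finitely many differences `m - n`. By linear independence of characters, the
corresponding exponentials satisfy one interpolation identity, with entire coefficients `a l` and
finitely many real nodes `l` (`exists_latticeExp_interpolation`). Comparing blocks, `V_k = ∑ a l k •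
V_l`. The `V_l` are fixed bounded operators, so replacing `k` by `z` in the coefficients gives the
entire extension, with no convergence of block matrices to check. For the second claim, Cauchy's
formula shows that directional derivatives of a holomorphic map are holomorphic; in finite dimension
induction gives smoothness, which is then restricted to `ℝᵈ`. The third is continuity of smooth
maps. -/

/-! ### Smoothness of holomorphic maps between normed spaces -/

section Holomorphic

variable {E F : Type*} [NormedAddCommGroup E] [NormedSpace ℂ E] [NormedAddCommGroup F]
  [NormedSpace ℂ F] {f : E → F} {U : Set E}

/-- The radius is written `4 * r` to leave room for balls of radius `r` around all points within `3
* r` of `z`. -/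
theorem ContinuousOn.exists_ball_subset_mapsTo {E F : Type*} [SeminormedAddCommGroup E]
    [SeminormedAddCommGroup F] {f : E → F} {U : Set E} (hU : IsOpen U) (hf : ContinuousOn f U) {z : E}
    (hz : z ∈ U) : ∃ r > 0, Metric.ball z (4 * r) ⊆ U ∧
      ∀ w ∈ Metric.ball z (4 * r), ‖f w - f z‖ < 1 := by
  have h1 : ∀ᶠ w in 𝓝 z, w ∈ U ∧ ‖f w - f z‖ < 1 := by
    filter_upwards [hU.mem_nhds hz,
      (hf.continuousAt (hU.mem_nhds hz)).eventually (Metric.ball_mem_nhds (f z) one_pos)] with w a b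
    exact ⟨a, by simpa [dist_eq_norm] using b⟩
  obtain ⟨r, hr, h⟩ := Metric.eventually_nhds_iff_ball.1 h1
  have e : 4 * (r / 4) = r := by ring
  exact ⟨r / 4, by positivity, fun w hw => (h w (e ▸ hw)).1, fun w hw => (h w (e ▸ hw)).2⟩

/-- Cauchy's estimate. The factor 2 arises because the Schwarz-type bound wants a target ball
centred at `f c` rather than at 0. -/
theorem DifferentiableOn.norm_fderiv_le {c : E} {r C : ℝ}
    (hf : DifferentiableOn ℂ f (Metric.ball c r)) (hr : 0 < r)
    (hC : ∀ w ∈ Metric.ball c r, ‖f w‖ ≤ C) : ‖fderiv ℂ f c‖ ≤ 2 * C / r := by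
  have h := Complex.norm_fderiv_le_div_of_mapsTo_ball (R₂ := 2 * C) hf ?_ hr
  · exact h
  · intro w hw
    have h1 := hC w hw
    have h2 := hC c (Metric.mem_ball_self hr)
    rw [Metric.mem_closedBall, dist_eq_norm]
    exact (norm_sub_le _ _).trans (by linarith)

/-- A holomorphic map has locally bounded derivative, and its derivative is locally Lipschitz. -/
theorem DifferentiableOn.exists_fderiv_bounds (hU : IsOpen U) (hf : DifferentiableOn ℂ f U) {z : E}
    (hz : z ∈ U) : ∃ r > 0, ∃ K L : ℝ, Metric.ball z r ⊆ U ∧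
      (∀ w ∈ Metric.ball z r, ‖fderiv ℂ f w‖ ≤ K) ∧
      ∀ w ∈ Metric.ball z r, ‖fderiv ℂ f w - fderiv ℂ f z‖ ≤ L * ‖w - z‖ := by
  obtain ⟨r, hr, hrU, hb⟩ := hf.continuousOn.exists_ball_subset_mapsTo hU hz
  have hdAt : ∀ w ∈ Metric.ball z (4 * r), DifferentiableAt ℂ f w := fun w hw =>
    hf.differentiableAt (hU.mem_nhds (hrU hw))
  have hsub : ∀ w ∈ Metric.ball z (3 * r), Metric.ball w r ⊆ Metric.ball z (4 * r) := by
    intro w hw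
    refine Metric.ball_subset_ball' ?_
    have := Metric.mem_ball.1 hw
    linarith
  have hK : ∀ w ∈ Metric.ball z (3 * r), ‖fderiv ℂ f w‖ ≤ 2 * 1 / r := by
    intro w hw
    have h1 : DifferentiableOn ℂ (fun v => f v - f z) (Metric.ball w r) := fun v hv =>
      ((hdAt v (hsub w hw hv)).sub_const _).differentiableWithinAt
    have := h1.norm_fderiv_le hr (fun v hv => (hb v (hsub w hw hv)).le)
    rwa [fderiv_sub_const] at this
  have hLip : ∀ w ∈ Metric.ball z (3 * r), ∀ v ∈ Metric.ball z (3 * r),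
      ‖f v - f w‖ ≤ 2 * 1 / r * ‖v - w‖ := fun w hw v hv =>
    (convex_ball z (3 * r)).norm_image_sub_le_of_norm_fderiv_le (𝕜 := ℂ)
      (fun x hx => hdAt x (Metric.ball_subset_ball (by linarith) hx)) hK hw hv
  refine ⟨r, hr, 2 * 1 / r, 2 * (2 * 1 / r) / r,
    (Metric.ball_subset_ball (by linarith)).trans hrU,
    fun w hw => hK w (Metric.ball_subset_ball (by linarith) hw), fun w hw => ?_⟩
  have hw' : ‖w - z‖ < r := by simpa [dist_eq_norm] using hw
  have hm1 : ∀ v ∈ Metric.ball z r, v ∈ Metric.ball z (3 * r) := fun v hv =>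
    Metric.ball_subset_ball (by linarith) hv
  have hm2 : ∀ v ∈ Metric.ball z r, v + (w - z) ∈ Metric.ball z (3 * r) := by
    intro v hv
    rw [Metric.mem_ball, dist_eq_norm] at hv ⊢
    calc ‖v + (w - z) - z‖ = ‖(v - z) + (w - z)‖ := by congr 1; abel
      _ ≤ ‖v - z‖ + ‖w - z‖ := norm_add_le _ _
      _ < 3 * r := by linarith
  have h34 : Metric.ball z (3 * r) ⊆ Metric.ball z (4 * r) :=
    Metric.ball_subset_ball (by linarith)
  have hd2 : ∀ v ∈ Metric.ball z r, DifferentiableAt ℂ (fun x => f (x + (w - z))) v := fun v hv =>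
    (hdAt _ (h34 (hm2 v hv))).comp v (by fun_prop)
  -- The derivative of this difference at `z` is `fderiv ℂ f w - fderiv ℂ f z`, and by `hLip` the
  -- difference is of size `‖w - z‖`; Cauchy's estimate therefore makes the derivative Lipschitz at
  -- `z`.
  have hd : DifferentiableOn ℂ (fun v => f (v + (w - z)) - f v) (Metric.ball z r) := fun v hv =>
    ((hd2 v hv).sub (hdAt v (h34 (hm1 v hv)))).differentiableWithinAt
  have := hd.norm_fderiv_le hr (C := 2 * 1 / r * ‖w - z‖) (fun v hv => by
    have := hLip v (hm1 v hv) _ (hm2 v hv)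
    simpa using this)
  have hz0 := Metric.mem_ball_self (x := z) hr
  rw [fderiv_fun_sub (hd2 z hz0) (hdAt z (h34 (hm1 z hz0))), fderiv_comp_add_right,
    add_sub_cancel] at this
  refine this.trans (le_of_eq ?_)
  ring

theorem DifferentiableOn.continuousOn_fderiv_of_isOpen (hU : IsOpen U) (hf : DifferentiableOn ℂ f U) :
    ContinuousOn (fderiv ℂ f) U := by
  intro z hz
  obtain ⟨r, hr, K, L, -, -, hL⟩ := hf.exists_fderiv_bounds hU hz
  refine ContinuousAt.continuousWithinAt ?_
  rw [ContinuousAt, tendsto_iff_norm_sub_tendsto_zero]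
  refine squeeze_zero' (Eventually.of_forall fun _ => norm_nonneg _)
    (Filter.eventually_of_mem (Metric.ball_mem_nhds z hr) hL) ?_
  have : Continuous fun w => L * ‖w - z‖ := by fun_prop
  simpa using this.tendsto z

/-- Cauchy's formula on a small circle in the direction `v` expresses the directional derivative by
values of `f` alone; the integral may be differentiated in the base point because `fderiv ℂ f` is
locally bounded and continuous. -/
theorem DifferentiableOn.fderiv_apply [CompleteSpace F] (hU : IsOpen U)
    (hf : DifferentiableOn ℂ f U) (v : E) : DifferentiableOn ℂ (fun z => fderiv ℂ f z v) U := by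
  intro z hz
  refine DifferentiableAt.differentiableWithinAt ?_
  obtain ⟨r, hr, K, L, hrU, hK, -⟩ := hf.exists_fderiv_bounds hU hz
  have hcont := hf.continuousOn_fderiv_of_isOpen hU
  -- Circles `w + ζ • v` with `|ζ| = ρ` and `w` within `r / 2` of `z` stay in the ball of radius
  -- `r`; the `+ 1` covers `v = 0`.
  set ρ : ℝ := r / (2 * (‖v‖ + 1)) with hρdef
  have hρ : 0 < ρ := by positivity
  have hρv : ρ * ‖v‖ < r / 2 := by
    rw [hρdef, div_mul_eq_mul_div, div_lt_div_iff₀ (by positivity) two_pos]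
    nlinarith [norm_nonneg v]
  have hmem : ∀ w ∈ Metric.ball z (r / 2), ∀ ζ ∈ Metric.closedBall (0 : ℂ) ρ,
      w + ζ • v ∈ Metric.ball z r := by
    intro w hw ζ hζ
    rw [Metric.mem_ball, dist_eq_norm] at hw ⊢
    have hζ' : ‖ζ‖ ≤ ρ := by simpa using hζ
    calc ‖w + ζ • v - z‖ = ‖(w - z) + ζ • v‖ := by congr 1; abel
      _ ≤ ‖w - z‖ + ‖ζ • v‖ := norm_add_le _ _
      _ = ‖w - z‖ + ‖ζ‖ * ‖v‖ := by rw [norm_smul]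
      _ < r := by nlinarith [mul_le_mul_of_nonneg_right hζ' (norm_nonneg v)]
  have hdAt : ∀ w ∈ Metric.ball z r, DifferentiableAt ℂ f w := fun w hw =>
    hf.differentiableAt (hU.mem_nhds (hrU hw))
  have hcirc : ∀ θ, circleMap 0 ρ θ ∈ Metric.closedBall (0 : ℂ) ρ := fun θ =>
    circleMap_mem_closedBall 0 hρ.le θ
  set c : ℝ → ℂ := fun θ => _root_.deriv (circleMap 0 ρ) θ * (1 / (circleMap 0 ρ θ - 0) ^ 2) with hc
  have hc_cont : Continuous c := by
    have h0 : ∀ θ, (circleMap 0 ρ θ - 0) ^ 2 ≠ 0 := fun θ =>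
      pow_ne_zero 2 (sub_ne_zero.2 (circleMap_ne_center hρ.ne'))
    have h1 : Continuous (circleMap 0 ρ) := continuous_circleMap 0 ρ
    simp only [hc, deriv_circleMap]
    exact (by fun_prop : Continuous fun θ => circleMap 0 ρ θ * Complex.I).mul
      (continuous_const.div (by fun_prop) h0)
  have hline : Continuous fun θ => circleMap 0 ρ θ • v :=
    (continuous_circleMap 0 ρ).smul continuous_const
  have key : ∀ w ∈ Metric.ball z (r / 2), fderiv ℂ f w v =
      (2 * Real.pi * Complex.I : ℂ)⁻¹ •
        ∫ θ in (0 : ℝ)..2 * Real.pi, c θ • f (w + circleMap 0 ρ θ • v) := by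
    intro w hw
    have hd : ∀ ζ ∈ Metric.closedBall (0 : ℂ) ρ,
        HasDerivAt (fun ζ : ℂ => f (w + ζ • v)) (fderiv ℂ f (w + ζ • v) v) ζ := by
      intro ζ hζ
      have h1 : HasDerivAt (fun ζ : ℂ => w + ζ • v) v ζ := by
        simpa using ((hasDerivAt_id ζ).smul_const v).const_add w
      exact (hdAt _ (hmem w hw ζ hζ)).hasFDerivAt.comp_hasDerivAt ζ h1
    have h2 := DifferentiableOn.deriv_eq_smul_circleIntegral (f := fun ζ : ℂ => f (w + ζ • v))
      (c := 0) hρ (fun ζ hζ => (hd ζ hζ).differentiableAt.differentiableWithinAt)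
    rw [(hd 0 (Metric.mem_closedBall_self hρ.le)).deriv, zero_smul, add_zero] at h2
    rw [eq_inv_smul_iff₀ Complex.two_pi_I_ne_zero, ← h2, circleIntegral]
    simp only [hc, mul_smul]
  have hD : HasFDerivAt (fun w => ∫ θ in (0 : ℝ)..2 * Real.pi, c θ • f (w + circleMap 0 ρ θ • v))
      (∫ θ in (0 : ℝ)..2 * Real.pi, c θ • fderiv ℂ f (z + circleMap 0 ρ θ • v)) z := by
    have hs : Metric.ball z (r / 2) ∈ 𝓝 z := Metric.ball_mem_nhds z (by positivity)
    have hfc : ∀ w ∈ Metric.ball z (r / 2),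
        Continuous fun θ => c θ • f (w + circleMap 0 ρ θ • v) := fun w hw =>
      hc_cont.smul (hf.continuousOn.comp_continuous (by fun_prop)
        fun θ => hrU (hmem w hw _ (hcirc θ)))
    have hz' : z ∈ Metric.ball z (r / 2) := Metric.mem_ball_self (by positivity)
    refine intervalIntegral.hasFDerivAt_integral_of_dominated_of_fderiv_le
      (F' := fun w θ => c θ • fderiv ℂ f (w + circleMap 0 ρ θ • v))
      (bound := fun θ => ‖c θ‖ * K) hs
      (eventually_of_mem hs fun w hw => (hfc w hw).aestronglyMeasurable)
      ((hfc z hz').intervalIntegrable _ _) ?_ ?_ ?_ ?_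
    · exact (hc_cont.smul (hcont.comp_continuous (by fun_prop)
        fun θ => hrU (hmem z hz' _ (hcirc θ)))).aestronglyMeasurable
    · refine Eventually.of_forall fun θ _ w hw => ?_
      rw [norm_smul]
      gcongr
      exact hK _ (hmem w hw _ (hcirc θ))
    · exact (hc_cont.norm.mul continuous_const).intervalIntegrable _ _
    · refine Eventually.of_forall fun θ _ w hw => ?_
      have h1 : HasFDerivAt (fun w : E => w + circleMap 0 ρ θ • v) (ContinuousLinearMap.id ℂ E) w :=
        (hasFDerivAt_id w).add_const _
      have := ((hdAt _ (hmem w hw _ (hcirc θ))).hasFDerivAt.comp w h1).const_smul (c θ)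
      exact this
  refine (hD.differentiableAt.const_smul (2 * Real.pi * Complex.I : ℂ)⁻¹).congr_of_eventuallyEq ?_
  exact eventually_of_mem (Metric.ball_mem_nhds z (by positivity)) key

/-- A holomorphic map on an open set of a finite-dimensional space is smooth. -/
theorem DifferentiableOn.contDiffOn_of_finiteDimensional [FiniteDimensional ℂ E] [CompleteSpace F]
    (hU : IsOpen U) (hf : DifferentiableOn ℂ f U) : ContDiffOn ℂ ∞ f U := by
  rw [contDiffOn_infty]
  intro n
  induction n generalizing f with
  | zero => exact contDiffOn_zero.2 hf.continuousOn
  | succ n ih =>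
    rw [Nat.cast_add, Nat.cast_one, contDiffOn_succ_iff_fderiv_of_isOpen hU]
    -- Finite dimension enters here: smoothness of an operator-valued map may be tested on each
    -- vector `v`.
    exact ⟨hf, by simp, contDiffOn_clm_apply.2 fun v => ih (hf.fderiv_apply hU v)⟩

end Holomorphic

/-! ### Bounded functional calculus of a spectral measure -/

namespace SpectralMeasure

variable {X : Type*} [MeasurableSpace X] {H : Type*} [NormedAddCommGroup H]
  [InnerProductSpace ℂ H] [CompleteSpace H] {E : SpectralMeasure X H} {f g : X → ℂ}
  {S T : H →L[ℂ] H} {A B : Set X} {C D : ℝ}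

theorem diagMeasure_real_univ (E : SpectralMeasure X H) (ξ : H) :
    (E.diagMeasure ξ).real univ = ‖ξ‖ ^ 2 := by
  rw [Measure.real, diagMeasure_univ, ENNReal.toReal_ofReal (by positivity)]

theorem diagMeasure_real (E : SpectralMeasure X H) (ξ : H) (hA : MeasurableSet A) :
    (E.diagMeasure ξ).real A = ‖E.proj A ξ‖ ^ 2 := by
  rw [Measure.real, diagMeasure_apply E ξ hA, E.inner_proj hA, Complex.ofReal_re,
    ENNReal.toReal_ofReal (by positivity)]

theorem integrable_of_bound (E : SpectralMeasure X H) (hf : Measurable f) (hC : ∀ x, ‖f x‖ ≤ C)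
    (ξ : H) : Integrable f (E.diagMeasure ξ) :=
  Integrable.of_bound hf.aestronglyMeasurable C (Eventually.of_forall hC)

theorem hasIntegral_proj (E : SpectralMeasure X H) (hA : MeasurableSet A) :
    E.HasIntegral (A.indicator fun _ => 1) (E.proj A) := by
  intro ξ
  rw [integral_indicator_const _ hA, diagMeasure_real E ξ hA, E.inner_proj hA]
  simp

theorem HasIntegral.add (hS : E.HasIntegral f S) (hT : E.HasIntegral g T)
    (hf : ∀ ξ, Integrable f (E.diagMeasure ξ)) (hg : ∀ ξ, Integrable g (E.diagMeasure ξ)) :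
    E.HasIntegral (fun x => f x + g x) (S + T) := fun ξ => by
  rw [integral_add (hf ξ) (hg ξ), ← hS ξ, ← hT ξ, ← inner_add_right]; rfl

theorem HasIntegral.sub (hS : E.HasIntegral f S) (hT : E.HasIntegral g T)
    (hf : ∀ ξ, Integrable f (E.diagMeasure ξ)) (hg : ∀ ξ, Integrable g (E.diagMeasure ξ)) :
    E.HasIntegral (fun x => f x - g x) (S - T) := fun ξ => by
  rw [integral_sub (hf ξ) (hg ξ), ← hS ξ, ← hT ξ, ← inner_sub_right]; rfl

theorem HasIntegral.const_smul (hS : E.HasIntegral f S) (c : ℂ) :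
    E.HasIntegral (fun x => c * f x) (c • S) := fun ξ => by
  rw [integral_const_mul, ← hS ξ, ← inner_smul_right]; rfl

theorem HasIntegral.sum {ι : Type*} {s : Finset ι} {f : ι → X → ℂ} {S : ι → H →L[ℂ] H}
    (hS : ∀ i ∈ s, E.HasIntegral (f i) (S i))
    (hf : ∀ i ∈ s, ∀ ξ, Integrable (f i) (E.diagMeasure ξ)) :
    E.HasIntegral (fun x => ∑ i ∈ s, f i x) (∑ i ∈ s, S i) := fun ξ => by
  rw [integral_finsetSum _ fun i hi => hf i hi ξ, sum_apply, inner_sum]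
  exact Finset.sum_congr rfl fun i hi => hS i hi ξ

theorem hasIntegral_one (E : SpectralMeasure X H) : E.HasIntegral (fun _ => 1) 1 := by
  intro ξ
  rw [integral_const, diagMeasure_real_univ]
  simp [inner_self_eq_norm_sq_to_K]

/-- The factor 2 comes from polarization; it is harmless, since the bound only serves to prove norm
convergence. -/
theorem HasIntegral.norm_le (hS : E.HasIntegral f S) (hC0 : 0 ≤ C) (hC : ∀ x, ‖f x‖ ≤ C) :
    ‖S‖ ≤ 2 * C := by
  refine norm_le_of_inner_le hC0 fun ξ => ?_
  rw [hS ξ, ← diagMeasure_real_univ E]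
  exact norm_integral_le_of_norm_le_const (Eventually.of_forall hC)

theorem proj_union (E : SpectralMeasure X H) (hA : MeasurableSet A) (hB : MeasurableSet B)
    (h : Disjoint A B) : E.proj (A ∪ B) = E.proj A + E.proj B := by
  refine (E.hasIntegral_proj (hA.union hB)).unique ?_
  have := (E.hasIntegral_proj hA).add (E.hasIntegral_proj hB)
    (fun ξ => (integrable_const _).indicator hA) (fun ξ => (integrable_const _).indicator hB)
  rwa [indicator_union_of_disjoint h]

theorem proj_mul_self (E : SpectralMeasure X H) (hA : MeasurableSet A) :
    E.proj A * E.proj A = E.proj A :=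
  (E.isStarProjection_proj A hA).isIdempotentElem.eq

/-- For `η = E(A) ξ` the set `A` already carries the full mass `‖η‖²` of `μ_η`, so nothing is left
for `B`. -/
theorem proj_mul_proj_of_disjoint (E : SpectralMeasure X H) (hA : MeasurableSet A)
    (hB : MeasurableSet B) (h : Disjoint A B) : E.proj B * E.proj A = 0 := by
  ext ξ
  have h1 : E.proj A (E.proj A ξ) = E.proj A ξ := congrArg (· ξ) (E.proj_mul_self hA)
  have h2 := measureReal_union (μ := E.diagMeasure (E.proj A ξ)) h hB
  have h3 := measureReal_mono (μ := E.diagMeasure (E.proj A ξ)) (subset_univ (A ∪ B))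
  rw [h2, diagMeasure_real_univ, diagMeasure_real E _ hA, diagMeasure_real E _ hB, h1] at h3
  have : ‖E.proj B (E.proj A ξ)‖ ^ 2 ≤ 0 := by linarith
  simpa using le_antisymm this (by positivity)

/-- Split both sets along `A ∩ B`; all cross terms are products over disjoint sets. -/
theorem proj_mul_proj (E : SpectralMeasure X H) (hA : MeasurableSet A) (hB : MeasurableSet B) :
    E.proj A * E.proj B = E.proj (A ∩ B) := by
  have h1 := E.proj_union (hA.inter hB) (hA.diff hB) disjoint_inf_sdiff
  have h2 := E.proj_union (hB.inter hA) (hB.diff hA) disjoint_inf_sdiff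
  rw [inter_union_sdiff] at h1 h2
  rw [h1, h2, inter_comm B A, add_mul, mul_add, mul_add, E.proj_mul_self (hA.inter hB),
    E.proj_mul_proj_of_disjoint (hB.diff hA) (hA.inter hB)
      (disjoint_sdiff_left.mono_right inter_subset_left),
    E.proj_mul_proj_of_disjoint (hA.inter hB) (hA.diff hB)
      (disjoint_sdiff_right.mono_left inter_subset_right),
    E.proj_mul_proj_of_disjoint (hB.diff hA) (hA.diff hB)
      (disjoint_sdiff_left.mono_right sdiff_subset)]
  simp

theorem diagMeasure_proj (E : SpectralMeasure X H) (hA : MeasurableSet A) (ξ : H) :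
    E.diagMeasure (E.proj A ξ) = (E.diagMeasure ξ).restrict A := by
  ext B hB
  rw [Measure.restrict_apply hB, ← measureReal_eq_measureReal_iff, diagMeasure_real E _ hB,
    diagMeasure_real E _ (hB.inter hA), ← E.proj_mul_proj hB hA]
  rfl

/-- A bounded operator integral is a norm limit of integrals of simple functions. -/
theorem HasIntegral.exists_simpleFunc_tendsto (hS : E.HasIntegral f S) (hf : Measurable f)
    (hC : ∀ x, ‖f x‖ ≤ C) : ∃ s : ℕ → SimpleFunc X ℂ,
      (∀ n x, ‖s n x - f x‖ ≤ 1 / ((n : ℝ) + 1)) ∧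
      Tendsto (fun n => ∑ y ∈ (s n).range, y • E.proj (s n ⁻¹' {y})) atTop (𝓝 S) := by
  have hpos : ∀ n : ℕ, (0 : ℝ) < 1 / ((n : ℝ) + 1) := fun n => Nat.one_div_pos_of_nat
  choose s hs using fun n : ℕ => exists_simpleFunc_near hf hC (hpos n)
  refine ⟨s, hs, ?_⟩
  rw [tendsto_iff_norm_sub_tendsto_zero]
  refine squeeze_zero (fun _ => norm_nonneg _) (fun n => ?_)
    (by simpa only [mul_zero] using tendsto_one_div_add_atTop_nhds_zero_nat.const_mul (2 : ℝ))
  exact ((E.hasIntegral_simpleFunc (s n)).sub hS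
    (fun ξ => SimpleFunc.integrable_of_isFiniteMeasure (s n))
    (E.integrable_of_bound hf hC)).norm_le (hpos n).le (hs n)

theorem HasIntegral.commute_proj (hS : E.HasIntegral f S) (hf : Measurable f)
    (hC : ∀ x, ‖f x‖ ≤ C) (hA : MeasurableSet A) : E.proj A * S = S * E.proj A := by
  obtain ⟨s, -, hs⟩ := hS.exists_simpleFunc_tendsto hf hC
  refine tendsto_nhds_unique (hs.const_mul (E.proj A)) ((hs.mul_const (E.proj A)).congr fun n => ?_)
  rw [Finset.sum_mul, Finset.mul_sum]
  refine Finset.sum_congr rfl fun y _ => ?_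
  have hm := (s n).measurableSet_fiber y
  rw [smul_mul_assoc, mul_smul_comm, E.proj_mul_proj hm hA, E.proj_mul_proj hA hm, inter_comm]

theorem HasIntegral.indicator (hS : E.HasIntegral f S) (hf : Measurable f)
    (hC : ∀ x, ‖f x‖ ≤ C) (hA : MeasurableSet A) :
    E.HasIntegral (A.indicator f) (E.proj A * S) := by
  intro ξ
  -- With the projection on both sides, the quadratic form at `ξ` becomes that of `S` at `E(A) ξ`,
  -- whose measure is the restriction of `μ_ξ` to `A`.
  have h1 : E.proj A * S = E.proj A * (S * E.proj A) := by
    rw [← hS.commute_proj hf hC hA, ← mul_assoc, E.proj_mul_self hA]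
  have h2 : ContinuousLinearMap.adjoint (E.proj A) = E.proj A :=
    (E.isStarProjection_proj A hA).isSelfAdjoint.star_eq
  rw [integral_indicator hA, ← diagMeasure_proj E hA, ← hS, h1]
  change inner ℂ ξ (E.proj A (S (E.proj A ξ))) = _
  rw [← ContinuousLinearMap.adjoint_inner_left, h2]

/-- Bounded operator integrals are multiplicative. -/
theorem HasIntegral.mul (hS : E.HasIntegral f S) (hT : E.HasIntegral g T) (hf : Measurable f)
    (hC : ∀ x, ‖f x‖ ≤ C) (hg : Measurable g) (hD : ∀ x, ‖g x‖ ≤ D) :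
    E.HasIntegral (fun x => f x * g x) (S * T) := by
  obtain ⟨s, hsf, hs⟩ := hS.exists_simpleFunc_tendsto hf hC
  -- For a simple first factor, the product is a finite combination of indicators times `g`. The
  -- general case follows by dominated convergence.
  have key : ∀ n, E.HasIntegral (fun x => s n x * g x)
      ((∑ y ∈ (s n).range, y • E.proj (s n ⁻¹' {y})) * T) := by
    intro n
    have h1 := HasIntegral.sum (s := (s n).range)
      (fun y _ => (hT.indicator hg hD ((s n).measurableSet_fiber y)).const_smul y)
      (fun y _ ξ => ((E.integrable_of_bound hg hD ξ).indicator
        ((s n).measurableSet_fiber y)).const_mul y)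
    convert h1 using 1
    · ext x
      rw [Finset.sum_eq_single_of_mem (s n x) (SimpleFunc.mem_range_self _ x)]
      · rw [indicator_of_mem (by simp)]
      · intro y _ hy
        rw [indicator_of_notMem (fun h => hy (by simpa using h.symm)), mul_zero]
    · simp [Finset.sum_mul]
  intro ξ
  have t1 := ((innerSL ℂ ξ).continuous.tendsto _).comp
    (((ContinuousLinearMap.apply ℂ H ξ).continuous.tendsto _).comp (hs.mul_const T))
  refine tendsto_nhds_unique t1 ?_
  refine Tendsto.congr (fun n => ((key n) ξ).symm) ?_
  refine tendsto_integral_of_dominated_convergence (fun _ => (C + 1) * D)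
    (fun n => ((s n).measurable.mul hg).aestronglyMeasurable) (integrable_const _)
    (fun n => Eventually.of_forall fun x => ?_) (Eventually.of_forall fun x => ?_)
  · have h1 : ‖s n x‖ ≤ C + 1 := by
      have h2 : 1 / ((n : ℝ) + 1) ≤ 1 := by
        rw [div_le_one (by positivity)]; linarith [n.cast_nonneg (α := ℝ)]
      calc ‖s n x‖ = ‖f x + (s n x - f x)‖ := by congr 1; ring
        _ ≤ ‖f x‖ + ‖s n x - f x‖ := norm_add_le _ _
        _ ≤ C + 1 := add_le_add (hC x) ((hsf n x).trans h2)
    rw [norm_mul]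
    exact mul_le_mul h1 (hD x) (norm_nonneg _) ((norm_nonneg _).trans h1)
  · refine Tendsto.mul_const _ ?_
    rw [tendsto_iff_norm_sub_tendsto_zero]
    exact squeeze_zero (fun _ => norm_nonneg _) (fun n => hsf n x)
      tendsto_one_div_add_atTop_nhds_zero_nat

theorem HasIntegral.pow (hS : E.HasIntegral f S) (hf : Measurable f) (hC : ∀ x, ‖f x‖ ≤ C)
    (n : ℕ) : E.HasIntegral (fun x => f x ^ n) (S ^ n) := by
  induction n with
  | zero => simpa using E.hasIntegral_one
  | succ n ih =>
    simp only [pow_succ]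
    refine ih.mul hS (hf.pow_const n) (C := C ^ n) (fun x => ?_) hf hC
    rw [norm_pow]
    exact pow_le_pow_left₀ (norm_nonneg _) (hC x) n

/-- Integrate the exponential series termwise; the `n`-th term is dominated by `C ^ n / n! * ‖ξ‖ ^
2`. -/
theorem HasIntegral.exp (hS : E.HasIntegral f S) (hf : Measurable f) (hC : ∀ x, ‖f x‖ ≤ C) :
    E.HasIntegral (fun x => Complex.exp (f x)) (NormedSpace.exp S) := by
  intro ξ
  have h0 : HasSum (fun n : ℕ => (n.factorial : ℂ)⁻¹ • S ^ n) (NormedSpace.exp S) :=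
    NormedSpace.exp_series_hasSum_exp' S
  have h1 : HasSum (fun n : ℕ => inner ℂ ξ (((n.factorial : ℂ)⁻¹ • S ^ n) ξ))
      (inner ℂ ξ (NormedSpace.exp S ξ)) :=
    h0.mapL ((innerSL ℂ ξ).comp (ContinuousLinearMap.apply ℂ H ξ))
  have hint : ∀ n : ℕ, Integrable (fun x => (n.factorial : ℂ)⁻¹ * f x ^ n) (E.diagMeasure ξ) :=
    fun n => (E.integrable_of_bound (C := C ^ n) (hf.pow_const n) (fun x => by
      rw [norm_pow]; exact pow_le_pow_left₀ (norm_nonneg _) (hC x) n) ξ).const_mul _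
  have h2 : HasSum (fun n : ℕ => ∫ x, (n.factorial : ℂ)⁻¹ * f x ^ n ∂E.diagMeasure ξ)
      (∫ x, ∑' n : ℕ, (n.factorial : ℂ)⁻¹ * f x ^ n ∂E.diagMeasure ξ) := by
    refine hasSum_integral_of_summable_integral_norm hint ?_
    refine Summable.of_nonneg_of_le (fun n => integral_nonneg fun x => norm_nonneg _)
      (fun n => ?_) ((Real.summable_pow_div_factorial C).mul_right (‖ξ‖ ^ 2))
    have hb : ∀ x, ‖(n.factorial : ℂ)⁻¹ * f x ^ n‖ ≤ C ^ n / n.factorial := fun x => by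
      rw [norm_mul, norm_inv, norm_pow, Complex.norm_natCast, div_eq_inv_mul]
      exact mul_le_mul_of_nonneg_left (pow_le_pow_left₀ (norm_nonneg _) (hC x) n) (by positivity)
    refine (integral_mono (hint n).norm (integrable_const _) hb).trans (le_of_eq ?_)
    rw [integral_const, diagMeasure_real_univ, smul_eq_mul, mul_comm]
  have h3 : ∀ x, ∑' n : ℕ, (n.factorial : ℂ)⁻¹ * f x ^ n = Complex.exp (f x) := fun x => by
    rw [Complex.exp_eq_exp_ℂ, NormedSpace.exp_eq_tsum ℂ]; rfl
  simp only [h3] at h2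
  have h4 : ∀ n : ℕ, inner ℂ ξ (((n.factorial : ℂ)⁻¹ • S ^ n) ξ) =
      ∫ x, (n.factorial : ℂ)⁻¹ * f x ^ n ∂E.diagMeasure ξ := fun n =>
    ((hS.pow hf hC n).const_smul _) ξ
  simp only [← h4] at h2
  exact h1.unique h2

/-- A vector is zero if all its components in a countable measurable partition are. -/
theorem eq_zero_of_forall_proj_fiber {ι : Type*} [Countable ι] [MeasurableSpace ι]
    [MeasurableSingletonClass ι] (E : SpectralMeasure X H) {q : X → ι} (hq : Measurable q)
    {H' : Type*} [NormedAddCommGroup H'] [NormedSpace ℂ H'] (T : H →L[ℂ] H')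
    (h : ∀ i, T.comp (E.proj (q ⁻¹' {i})) = 0) : T = 0 := by
  obtain ⟨e, he⟩ := Countable.exists_injective_nat ι
  -- Countable additivity is indexed by `ℕ`, so the partition is transported along `e`, with empty
  -- sets for indices outside its range.
  have hfib : ∀ n : ℕ, (∃ i, q ⁻¹' (e ⁻¹' {n}) = q ⁻¹' {i}) ∨ q ⁻¹' (e ⁻¹' {n}) = ∅ := by
    intro n
    by_cases hn : ∃ i, e i = n
    · obtain ⟨i, rfl⟩ := hn
      exact Or.inl ⟨i, by ext x; simp [he.eq_iff]⟩
    · right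
      ext x
      simp only [mem_preimage, mem_singleton_iff, mem_empty_iff_false, iff_false]
      exact fun hx => hn ⟨_, hx⟩
  have hT : ∀ n ξ, T (E.proj (q ⁻¹' (e ⁻¹' {n})) ξ) = 0 := by
    intro n ξ
    rcases hfib n with ⟨i, hi⟩ | h0
    · rw [hi]; exact congrArg (· ξ) (h i)
    · rw [h0, E.proj_empty_apply, map_zero]
  ext ξ
  have hs := E.hasSum_proj (fun n => q ⁻¹' (e ⁻¹' {n}))
    (fun n => hq (Set.to_countable _).measurableSet)
    (fun m n hmn => by
      refine Set.disjoint_left.2 fun x h1 h2 => hmn ?_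
      exact (h1.symm.trans h2)) ξ
  have hU : ⋃ n, q ⁻¹' (e ⁻¹' {n}) = univ := by ext x; simp
  rw [hU, E.proj_univ] at hs
  have := T.hasSum hs
  simp only [hT] at this
  exact this.unique hasSum_zero

/-- Dual to the previous lemma, applied to the functional `⟨T η, ·⟩` since the projections are
self-adjoint. -/
theorem eq_zero_of_forall_proj_fiber_comp {ι : Type*} [Countable ι] [MeasurableSpace ι]
    [MeasurableSingletonClass ι] (E : SpectralMeasure X H) {q : X → ι} (hq : Measurable q)
    {H' : Type*} [NormedAddCommGroup H'] [NormedSpace ℂ H'] (T : H' →L[ℂ] H)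
    (h : ∀ i, (E.proj (q ⁻¹' {i})).comp T = 0) : T = 0 := by
  ext η
  have := E.eq_zero_of_forall_proj_fiber hq (innerSL ℂ (T η)) fun i => by
    have hm : MeasurableSet (q ⁻¹' {i}) := hq (measurableSet_singleton i)
    have h2 : ContinuousLinearMap.adjoint (E.proj (q ⁻¹' {i})) = E.proj (q ⁻¹' {i}) :=
      (E.isStarProjection_proj _ hm).isSelfAdjoint.star_eq
    ext ξ
    change inner ℂ (T η) (E.proj (q ⁻¹' {i}) ξ) = 0
    rw [← ContinuousLinearMap.adjoint_inner_left, h2]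
    have h3 : E.proj (q ⁻¹' {i}) (T η) = 0 := congrArg (· η) (h i)
    rw [h3, inner_zero_left]
  have h4 : inner ℂ (T η) (T η) = 0 := congrArg (· (T η)) this
  simpa using h4

end SpectralMeasure

/-! ### Interpolation of exponentials with integer frequencies -/

section Interpolation

/-- Evaluations at points span the dual of a finite linearly independent family of functions. -/
theorem LinearIndependent.span_range_eval_eq_top {K ι X : Type*} [Field K] [Finite ι]
    {f : ι → X → K} (hf : LinearIndependent K f) :
    Submodule.span K (range fun x i => f i x) = ⊤ := by
  classical
  cases nonempty_fintype ι
  by_contra h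
  -- A functional killing every evaluation vector is a linear relation among the `f i`, with
  -- coefficients `φ (Pi.single i 1)`.
  obtain ⟨φ, hφ, hle⟩ := Submodule.exists_le_ker_of_lt_top _ (lt_top_iff_ne_top.2 h)
  refine hφ (LinearMap.pi_ext' fun i => LinearMap.ext_ring ?_)
  refine Fintype.linearIndependent_iff.1 hf (fun i => φ (Pi.single i 1)) ?_ i
  ext x
  have h0 : φ (fun i => f i x) = 0 := hle (Submodule.subset_span ⟨x, rfl⟩)
  rw [LinearMap.pi_apply_eq_sum_univ φ] at h0
  simp only [Finset.sum_apply, Pi.smul_apply, smul_eq_mul, Pi.zero_apply]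
  rw [← h0]
  refine Finset.sum_congr rfl fun i _ => ?_
  rw [smul_eq_mul, mul_comm]
  congr 2
  ext j
  simp [Pi.single_apply, eq_comm]

variable {d : ℕ}

/-- The exponential `exp (i z·m)` for `z ∈ ℂᵈ`, `m ∈ ℤᵈ`. -/
noncomputable def latticeExp (z : EuclideanSpace ℂ (Fin d)) (m : Fin d → ℤ) : ℂ :=
  Complex.exp (Complex.I * ∑ j, z j * (m j : ℂ))

theorem latticeExp_add (z w : EuclideanSpace ℂ (Fin d)) (m : Fin d → ℤ) :
    latticeExp (z + w) m = latticeExp z m * latticeExp w m := by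
  simp only [latticeExp, ← Complex.exp_add, ← mul_add, ← Finset.sum_add_distrib, ← add_mul,
    PiLp.add_apply]

theorem latticeExp_sub_right (z : EuclideanSpace ℂ (Fin d)) (m n : Fin d → ℤ) :
    latticeExp z (m - n) = latticeExp z m * latticeExp (-z) n := by
  simp only [latticeExp, ← Complex.exp_add, ← mul_add, ← Finset.sum_add_distrib]
  congr 3
  ext j
  simp
  ring

theorem complexify_add (k l : EuclideanSpace ℝ (Fin d)) :
    complexify (k + l) = complexify k + complexify l := by
  ext j; simp [complexify]

theorem complexify_neg (k : EuclideanSpace ℝ (Fin d)) : complexify (-k) = -complexify k := by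
  ext j; simp [complexify]

theorem complexify_zero : complexify (0 : EuclideanSpace ℝ (Fin d)) = 0 := by
  ext j; simp [complexify]

theorem latticeExp_zero_left (m : Fin d → ℤ) : latticeExp 0 m = 1 := by
  simp [latticeExp]

theorem differentiable_latticeExp (m : Fin d → ℤ) :
    Differentiable ℂ fun z : EuclideanSpace ℂ (Fin d) => latticeExp z m := by
  unfold latticeExp
  fun_prop

theorem norm_latticeExp_complexify (k : EuclideanSpace ℝ (Fin d)) (m : Fin d → ℤ) :
    ‖latticeExp (complexify k) m‖ = 1 := by
  have : Complex.I * ∑ j, complexify k j * (m j : ℂ) =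
      ((∑ j, k j * (m j : ℝ) : ℝ) : ℂ) * Complex.I := by
    simp [complexify, mul_comm]
  rw [latticeExp, this, Complex.norm_exp_ofReal_mul_I]

/-- The character of `ℝᵈ` attached to a lattice point. -/
noncomputable def latticeChar (m : Fin d → ℤ) : Multiplicative (EuclideanSpace ℝ (Fin d)) →* ℂ where
  toFun k := latticeExp (complexify k.toAdd) m
  map_one' := by
    rw [toAdd_one, complexify_zero, latticeExp_zero_left]
  map_mul' k l := by
    rw [toAdd_mul, complexify_add, latticeExp_add]

theorem latticeChar_injective : Function.Injective (latticeChar (d := d)) := by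
  intro m n h
  ext j
  by_contra hne
  have hu : (m j : ℝ) - n j ≠ 0 := sub_ne_zero.2 (by exact_mod_cast hne)
  -- At `t` times the `j`-th basis vector the two characters have quotient `exp (i π) = -1`.
  set t : ℝ := Real.pi / ((m j : ℝ) - n j) with ht
  have h1 : latticeExp (complexify (EuclideanSpace.single j t)) m =
      latticeExp (complexify (EuclideanSpace.single j t)) n :=
    DFunLike.congr_fun h (Multiplicative.ofAdd (EuclideanSpace.single j t))
  have h2 : ∀ l : Fin d → ℤ, latticeExp (complexify (EuclideanSpace.single j t)) l =
      Complex.exp (Complex.I * (t * l j)) := by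
    intro l
    rw [latticeExp, Finset.sum_eq_single j]
    · simp [complexify]
    · intro i _ hi
      simp [complexify, hi]
    · simp
  rw [h2, h2, ← div_eq_one_iff_eq (Complex.exp_ne_zero _), ← Complex.exp_sub] at h1
  have h3 : Complex.I * (t * m j) - Complex.I * (t * n j) = Real.pi * Complex.I := by
    have : t * ((m j : ℝ) - n j) = Real.pi := by rw [ht]; field_simp
    rw [← this]; push_cast; ring
  rw [h3, Complex.exp_pi_mul_I] at h1
  norm_num at h1

/-- Interpolation: finitely many exponentials with integer frequencies are determined, with
entire coefficients, by their values at finitely many real points. -/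
theorem exists_latticeExp_interpolation (M : Finset (Fin d → ℤ)) :
    ∃ (t : Finset (EuclideanSpace ℝ (Fin d)))
      (a : EuclideanSpace ℝ (Fin d) → EuclideanSpace ℂ (Fin d) → ℂ),
      (∀ l, Differentiable ℂ (a l)) ∧ ∀ m ∈ M, ∀ z,
        latticeExp z m = ∑ l ∈ t, a l z * latticeExp (complexify l) m := by
  classical
  have hli : LinearIndependent ℂ fun (m : M) (k : Multiplicative (EuclideanSpace ℝ (Fin d))) =>
      latticeChar m.1 k :=
    (linearIndependent_monoidHom _ ℂ).comp (fun m : M => latticeChar m.1)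
      (latticeChar_injective.comp Subtype.val_injective)
  have hspan := hli.span_range_eval_eq_top
  -- Each coordinate vector is a finite combination of evaluations. The weights `c m`, multiplied by
  -- `latticeExp z m` and summed over `m`, give the entire coefficients.
  have hc : ∀ m : M, ∃ c : Multiplicative (EuclideanSpace ℝ (Fin d)) →₀ ℂ,
      (c.sum fun k b => b • fun m' : M => latticeChar m'.1 k) = Pi.single m 1 := fun m =>
    Finsupp.mem_span_range_iff_exists_finsupp.1 (hspan ▸ Submodule.mem_top)
  choose c hc using hc
  refine ⟨Finset.univ.biUnion fun m : M => (c m).support,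
    fun l z => ∑ m : M, latticeExp z m.1 * c m (Multiplicative.ofAdd l), fun l => ?_, ?_⟩
  · exact Differentiable.fun_sum fun m _ => (differentiable_latticeExp m.1).mul_const _
  · intro m hm z
    have h1 : ∀ m' : M, ∑ l ∈ Finset.univ.biUnion fun m : M => (c m).support,
        c m' l * latticeChar m l = (Pi.single m' 1 : M → ℂ) ⟨m, hm⟩ := by
      intro m'
      rw [← hc m', Finsupp.sum, Finset.sum_apply]
      symm
      refine Finset.sum_subset (Finset.subset_biUnion_of_mem (fun m : M => (c m).support)
        (Finset.mem_univ m')) fun k _ hk => ?_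
      rw [Finsupp.notMem_support_iff.1 hk]
      simp
    have h2 : ∑ m' : M, latticeExp z m'.1 * (Pi.single m' 1 : M → ℂ) ⟨m, hm⟩ = latticeExp z m := by
      rw [Finset.sum_eq_single ⟨m, hm⟩]
      · simp
      · intro b _ hb
        simp [hb.symm]
      · simp
    rw [← h2]
    simp only [← h1, Finset.mul_sum]
    rw [Finset.sum_comm]
    refine Finset.sum_congr rfl fun l _ => ?_
    rw [Finset.sum_mul]
    refine Finset.sum_congr rfl fun m' _ => ?_
    rw [mul_assoc]
    rfl

end Interpolation

/-! ### Integer and fractional parts of the coordinates, and the theorem -/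

section Lattice

variable {d : ℕ}

/-- The coordinatewise integer part of a vector. -/
noncomputable def floorVec (x : EuclideanSpace ℝ (Fin d)) : Fin d → ℤ := fun j => ⌊x j⌋

theorem measurable_floorVec : Measurable (floorVec (d := d)) :=
  measurable_pi_lambda _ fun j => Int.measurable_floor.comp (by fun_prop)

theorem lt_setEDist_floorVec_fiber {R : ℝ≥0} {m n : Fin d → ℤ} {j : Fin d}
    (h : (R : ℝ) + 2 < |(m j : ℝ) - n j|) :
    (R : ℝ≥0∞) < setEDist (floorVec ⁻¹' {n}) (floorVec ⁻¹' {m}) := by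
  -- Of the margin 2, one unit is lost to the width of the cells; the other keeps the inequality
  -- strict after taking the infimum.
  have h1 : (R : ℝ≥0∞) < ((R + 1 : ℝ≥0) : ℝ≥0∞) := by
    exact_mod_cast lt_add_one R
  refine h1.trans_le (le_iInf₂ fun x (hx : floorVec x = n) => le_iInf₂ fun y (hy : floorVec y = m) => ?_)
  have hx' : ⌊x j⌋ = n j := congrFun hx j
  have hy' : ⌊y j⌋ = m j := congrFun hy j
  have hx1 := Int.floor_le (x j)
  have hx2 := Int.lt_floor_add_one (x j)
  have hy1 := Int.floor_le (y j)
  have hy2 := Int.lt_floor_add_one (y j)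
  rw [hx'] at hx1 hx2
  rw [hy'] at hy1 hy2
  have h2 : (R : ℝ) + 1 ≤ |x j - y j| := by
    rcases lt_abs.1 h with h | h
    · exact le_abs.2 (Or.inr (by linarith))
    · exact le_abs.2 (Or.inl (by linarith))
  have h3 : |x j - y j| ≤ dist x y := by
    rw [dist_eq_norm, ← Real.norm_eq_abs]
    exact PiLp.norm_apply_le (x - y) j
  rw [edist_nndist, ENNReal.coe_le_coe, ← NNReal.coe_le_coe, coe_nndist]
  push_cast
  linarith

namespace SpectralMeasure

variable {H : Type*} [NormedAddCommGroup H] [InnerProductSpace ℂ H] [CompleteSpace H]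
  (E : SpectralMeasure (EuclideanSpace ℝ (Fin d)) H)

theorem measurableSet_floorVec_fiber (n : Fin d → ℤ) :
    MeasurableSet (floorVec ⁻¹' {n} : Set (EuclideanSpace ℝ (Fin d))) :=
  measurable_floorVec (measurableSet_singleton n)

/-- The operator `∫ exp (i k·⌊x⌋) dE(x)`. -/
noncomputable def latticeRep (k : EuclideanSpace ℝ (Fin d)) : H →L[ℂ] H :=
  E.integral fun x => latticeExp (complexify k) (floorVec x)

theorem measurable_latticeExp_floorVec (z : EuclideanSpace ℂ (Fin d)) :
    Measurable fun x : EuclideanSpace ℝ (Fin d) => latticeExp z (floorVec x) :=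
  (measurable_of_countable (latticeExp z)).comp measurable_floorVec

theorem hasIntegral_latticeRep (k : EuclideanSpace ℝ (Fin d)) :
    E.HasIntegral (fun x => latticeExp (complexify k) (floorVec x)) (E.latticeRep k) :=
  E.hasIntegral_integral (measurable_latticeExp_floorVec _)
    fun _ => (norm_latticeExp_complexify k _).le

theorem proj_mul_latticeRep (k : EuclideanSpace ℝ (Fin d)) (n : Fin d → ℤ) :
    E.proj (floorVec ⁻¹' {n}) * E.latticeRep k =
      latticeExp (complexify k) n • E.proj (floorVec ⁻¹' {n}) := by
  refine ((E.hasIntegral_latticeRep k).indicator (measurable_latticeExp_floorVec _)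
    (fun x => (norm_latticeExp_complexify k _).le) (measurableSet_floorVec_fiber n)).unique ?_
  convert (E.hasIntegral_proj (measurableSet_floorVec_fiber n)).const_smul
    (latticeExp (complexify k) n) using 1
  ext x
  by_cases hx : floorVec x = n
  · simp [indicator, hx]
  · simp [indicator, hx]

theorem latticeRep_mul_proj (k : EuclideanSpace ℝ (Fin d)) (n : Fin d → ℤ) :
    E.latticeRep k * E.proj (floorVec ⁻¹' {n}) =
      latticeExp (complexify k) n • E.proj (floorVec ⁻¹' {n}) := by
  rw [← (E.hasIntegral_latticeRep k).commute_proj (measurable_latticeExp_floorVec _)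
    (fun x => (norm_latticeExp_complexify k _).le) (measurableSet_floorVec_fiber n),
    proj_mul_latticeRep]

/-- The operator `∫ {xⱼ} dE(x)`, where `{xⱼ}` is the fractional part of the `j`-th coordinate. -/
noncomputable def fractOp (j : Fin d) : H →L[ℂ] H :=
  E.integral fun x => ((Int.fract (x j) : ℝ) : ℂ)

theorem measurable_fract_apply (j : Fin d) :
    Measurable fun x : EuclideanSpace ℝ (Fin d) => ((Int.fract (x j) : ℝ) : ℂ) :=
  Complex.measurable_ofReal.comp (measurable_fract.comp (by fun_prop))

theorem norm_fract_apply_le (x : EuclideanSpace ℝ (Fin d)) (j : Fin d) :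
    ‖((Int.fract (x j) : ℝ) : ℂ)‖ ≤ 1 := by
  rw [Complex.norm_real, Real.norm_of_nonneg (Int.fract_nonneg _)]
  exact (Int.fract_lt_one _).le

/-- The entire operator-valued function `z ↦ ∫ exp (i z·{x}) dE(x)`. -/
noncomputable def fractExp (z : EuclideanSpace ℂ (Fin d)) : H →L[ℂ] H :=
  NormedSpace.exp (∑ j, (Complex.I * z j) • E.fractOp j)

/-- The exponent is linear in `z` with bounded operator coefficients, and the operator exponential
is analytic. -/
theorem differentiable_fractExp : Differentiable ℂ E.fractExp := by
  intro z
  have h1 : DifferentiableAt ℂ (fun z : EuclideanSpace ℂ (Fin d) =>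
      ∑ j, (Complex.I * z j) • E.fractOp j) z := by fun_prop
  exact (NormedSpace.exp_analytic (𝕂 := ℂ) _).differentiableAt.comp z h1

theorem measurable_sum_fract (z : EuclideanSpace ℂ (Fin d)) :
    Measurable fun x : EuclideanSpace ℝ (Fin d) =>
      ∑ j, (Complex.I * z j) * ((Int.fract (x j) : ℝ) : ℂ) :=
  Finset.measurable_fun_sum _ fun j _ => (measurable_fract_apply j).const_mul _

theorem norm_sum_fract_le (z : EuclideanSpace ℂ (Fin d)) (x : EuclideanSpace ℝ (Fin d)) :
    ‖∑ j, (Complex.I * z j) * ((Int.fract (x j) : ℝ) : ℂ)‖ ≤ ∑ j, ‖z j‖ := by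
  refine (norm_sum_le _ _).trans (Finset.sum_le_sum fun j _ => ?_)
  rw [norm_mul, norm_mul, Complex.norm_I, one_mul]
  exact mul_le_of_le_one_right (norm_nonneg _) (norm_fract_apply_le x j)

theorem hasIntegral_fractExp (z : EuclideanSpace ℂ (Fin d)) :
    E.HasIntegral (fun x => Complex.exp (∑ j, (Complex.I * z j) * ((Int.fract (x j) : ℝ) : ℂ)))
      (E.fractExp z) :=
  (HasIntegral.sum (fun j _ => (E.hasIntegral_integral (measurable_fract_apply j)
      fun x => norm_fract_apply_le x j).const_smul (Complex.I * z j))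
    fun j _ ξ => (E.integrable_of_bound (measurable_fract_apply j)
      (fun x => norm_fract_apply_le x j) ξ).const_mul _).exp
    (measurable_sum_fract z) (norm_sum_fract_le z)

theorem exp_sum_fract_mul_latticeExp (k x : EuclideanSpace ℝ (Fin d)) :
    Complex.exp (∑ j, (Complex.I * complexify k j) * ((Int.fract (x j) : ℝ) : ℂ)) *
      latticeExp (complexify k) (floorVec x) =
    Complex.exp (Complex.I * ((inner ℝ x k : ℝ) : ℂ)) := by
  rw [latticeExp, ← Complex.exp_add, Finset.mul_sum, ← Finset.sum_add_distrib, PiLp.inner_apply,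
    Complex.ofReal_sum, Finset.mul_sum]
  congr 1
  refine Finset.sum_congr rfl fun j _ => ?_
  have : ((x j : ℝ) : ℂ) = (⌊x j⌋ : ℂ) + ((Int.fract (x j) : ℝ) : ℂ) := by
    exact_mod_cast congrArg Complex.ofReal (Int.floor_add_fract (x j)).symm
  simp only [complexify, floorVec, RCLike.inner_apply, conj_trivial, Complex.ofReal_mul, this]
  ring

theorem norm_exp_sum_fract_le (z : EuclideanSpace ℂ (Fin d)) (x : EuclideanSpace ℝ (Fin d)) :
    ‖Complex.exp (∑ j, (Complex.I * z j) * ((Int.fract (x j) : ℝ) : ℂ))‖ ≤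
      Real.exp (∑ j, ‖z j‖) :=
  (Complex.norm_exp_le_exp_norm _).trans (Real.exp_le_exp.2 (norm_sum_fract_le z x))

/-- Both orders of the factors are needed: in `W_k` the lattice factors must stand next to `W` on
either side. -/
theorem rep_eq_fractExp_mul_latticeRep (k : EuclideanSpace ℝ (Fin d)) :
    E.rep k = E.fractExp (complexify k) * E.latticeRep k := by
  refine (E.hasIntegral_rep k).unique ?_
  simp only [← exp_sum_fract_mul_latticeExp]
  exact (E.hasIntegral_fractExp _).mul (E.hasIntegral_latticeRep k)
    (Complex.measurable_exp.comp (measurable_sum_fract _)) (norm_exp_sum_fract_le _)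
    (measurable_latticeExp_floorVec _) fun x => (norm_latticeExp_complexify k _).le

theorem rep_eq_latticeRep_mul_fractExp (k : EuclideanSpace ℝ (Fin d)) :
    E.rep k = E.latticeRep k * E.fractExp (complexify k) := by
  refine (E.hasIntegral_rep k).unique ?_
  simp only [← exp_sum_fract_mul_latticeExp, mul_comm (Complex.exp _)]
  exact (E.hasIntegral_latticeRep k).mul (E.hasIntegral_fractExp _)
    (measurable_latticeExp_floorVec _) (fun x => (norm_latticeExp_complexify k _).le)
    (Complex.measurable_exp.comp (measurable_sum_fract _)) (norm_exp_sum_fract_le _)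

end SpectralMeasure

variable {H₁ H₂ : Type*} [NormedAddCommGroup H₁] [InnerProductSpace ℂ H₁]
  [CompleteSpace H₁] [NormedAddCommGroup H₂] [InnerProductSpace ℂ H₂] [CompleteSpace H₂]
  {E₁ : SpectralMeasure (EuclideanSpace ℝ (Fin d)) H₁}
  {E₂ : SpectralMeasure (EuclideanSpace ℝ (Fin d)) H₂} {W : H₁ →L[ℂ] H₂}

/-- On each cell the lattice phase is constant, so `k` enters a block only through a scalar
depending on `m - n`. -/
theorem proj_comp_latticeRep_conj_comp_proj (k : EuclideanSpace ℝ (Fin d)) (m n : Fin d → ℤ) :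
    (E₂.proj (floorVec ⁻¹' {m})).comp
      (((E₂.latticeRep k).comp (W.comp (E₁.latticeRep (-k)))).comp (E₁.proj (floorVec ⁻¹' {n}))) =
    latticeExp (complexify k) (m - n) •
      (E₂.proj (floorVec ⁻¹' {m})).comp (W.comp (E₁.proj (floorVec ⁻¹' {n}))) := by
  ext ξ
  have h1 : ∀ η, E₂.proj (floorVec ⁻¹' {m}) (E₂.latticeRep k η) =
      latticeExp (complexify k) m • E₂.proj (floorVec ⁻¹' {m}) η := fun η =>
    congrArg (· η) (E₂.proj_mul_latticeRep k m)
  have h2 : E₁.latticeRep (-k) (E₁.proj (floorVec ⁻¹' {n}) ξ) =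
      latticeExp (complexify (-k)) n • E₁.proj (floorVec ⁻¹' {n}) ξ :=
    congrArg (· ξ) (E₁.latticeRep_mul_proj (-k) n)
  simp only [ContinuousLinearMap.comp_apply, smul_apply, h1, h2, map_smul, smul_smul,
    latticeExp_sub_right, complexify_neg, mul_comm]

/-- For an operator of finite propagation, the discretized family is a finite combination of some
of its own members, with entire coefficients. -/
theorem HasFinitePropagation.exists_latticeRep_interpolation
    (hW : HasFinitePropagation E₁ E₂ W) :
    ∃ (t : Finset (EuclideanSpace ℝ (Fin d)))
      (a : EuclideanSpace ℝ (Fin d) → EuclideanSpace ℂ (Fin d) → ℂ),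
      (∀ l, Differentiable ℂ (a l)) ∧ ∀ k,
        (E₂.latticeRep k).comp (W.comp (E₁.latticeRep (-k))) =
          ∑ l ∈ t, a l (complexify k) • (E₂.latticeRep l).comp (W.comp (E₁.latticeRep (-l))) := by
  obtain ⟨R, hR⟩ := hW
  obtain ⟨N, hN⟩ := exists_nat_ge ((R : ℝ) + 2)
  obtain ⟨t, a, ha, h⟩ := exists_latticeExp_interpolation
    (Finset.Icc (fun _ : Fin d => -(N : ℤ)) (fun _ => (N : ℤ)))
  refine ⟨t, a, ha, fun k => ?_⟩
  rw [← sub_eq_zero]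
  refine E₂.eq_zero_of_forall_proj_fiber_comp measurable_floorVec _ fun m => ?_
  refine E₁.eq_zero_of_forall_proj_fiber measurable_floorVec _ fun n => ?_
  rw [ContinuousLinearMap.comp_assoc]
  have e : ∀ (A B : H₁ →L[ℂ] H₂) (P : H₂ →L[ℂ] H₂) (Q : H₁ →L[ℂ] H₁),
      P.comp ((A - B).comp Q) = P.comp (A.comp Q) - P.comp (B.comp Q) := by
    intros; ext; simp
  have e' : ∀ (c : EuclideanSpace ℝ (Fin d) → ℂ) (B : EuclideanSpace ℝ (Fin d) → H₁ →L[ℂ] H₂)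
      (P : H₂ →L[ℂ] H₂) (Q : H₁ →L[ℂ] H₁),
      P.comp ((∑ l ∈ t, c l • B l).comp Q) = ∑ l ∈ t, c l • P.comp ((B l).comp Q) := by
    intros; ext; simp
  rw [e, e']
  simp only [proj_comp_latticeRep_conj_comp_proj]
  -- Inside the box the scalar interpolation identity applies; outside, the cells are farther apart
  -- than `R` and the block of `W` vanishes.
  by_cases hmn : m - n ∈ Finset.Icc (fun _ : Fin d => -(N : ℤ)) (fun _ => (N : ℤ))
  · rw [h _ hmn, Finset.sum_smul]
    simp only [mul_smul, sub_self]
  · have hj : ∃ j, (N : ℝ) < |(m j : ℝ) - n j| := by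
      by_contra! hcon
      refine hmn (Finset.mem_Icc.2 ⟨fun j => ?_, fun j => ?_⟩)
      · have := (abs_le.1 (hcon j)).1
        exact_mod_cast this
      · have := (abs_le.1 (hcon j)).2
        exact_mod_cast this
    obtain ⟨j, hj⟩ := hj
    have h0 := hR _ _ (SpectralMeasure.measurableSet_floorVec_fiber n)
      (SpectralMeasure.measurableSet_floorVec_fiber m)
      (lt_setEDist_floorVec_fiber (j := j) (hN.trans_lt hj))
    simp [h0]

theorem HasFinitePropagation.extendsHolomorphicallyTo_univ (hW : HasFinitePropagation E₁ E₂ W) :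
    ExtendsHolomorphicallyTo E₁ E₂ W Set.univ := by
  obtain ⟨t, a, ha, h⟩ := hW.exists_latticeRep_interpolation
  -- Only the fractional exponentials and the scalars `a l` depend on `z`; the operators at the
  -- nodes `l` are fixed.
  refine ⟨fun z => (E₂.fractExp z).comp ((∑ l ∈ t, a l z •
    (E₂.latticeRep l).comp (W.comp (E₁.latticeRep (-l)))).comp (E₁.fractExp (-z))), ?_, fun k => ?_⟩
  · refine Differentiable.differentiableOn ?_
    refine E₂.differentiable_fractExp.clm_comp (Differentiable.clm_comp ?_ ?_)
    · exact Differentiable.fun_sum fun l _ => (ha l).smul_const _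
    · exact E₁.differentiable_fractExp.comp (by fun_prop :
        Differentiable ℂ fun z : EuclideanSpace ℂ (Fin d) => -z)
  · beta_reduce
    rw [← h, conjFamily, E₂.rep_eq_fractExp_mul_latticeRep, E₁.rep_eq_latticeRep_mul_fractExp,
      complexify_neg]
    rfl

theorem HasFinitePropagation.isAnalyticMorphism (hW : HasFinitePropagation E₁ E₂ W) :
    IsAnalyticMorphism E₁ E₂ W :=
  ⟨univ, isOpen_univ, isConnected_univ, subset_univ _, hW.extendsHolomorphicallyTo_univ⟩

theorem contDiff_complexify : ContDiff ℝ ∞ (complexify (d := d)) :=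
  (IsLinearMap.mk' complexify ⟨complexify_add, fun c k => by
    ext j; simp [complexify]⟩).toContinuousLinearMap.contDiff

theorem IsAnalyticMorphism.isSmoothMorphism (hW : IsAnalyticMorphism E₁ E₂ W) :
    IsSmoothMorphism E₁ E₂ W := by
  obtain ⟨U, hU, -, hsub, F, hF, hFk⟩ := hW
  have h1 : ContDiffOn ℝ ∞ F U := (hF.contDiffOn_of_finiteDimensional hU).restrict_scalars ℝ
  have h2 := h1.comp_contDiff contDiff_complexify fun k => hsub ⟨k, rfl⟩
  rw [IsSmoothMorphism, ← funext hFk]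
  exact h2

end Lattice

theorem mainTheorem4 {d : ℕ} {H₁ H₂ : Type*}
    [NormedAddCommGroup H₁] [InnerProductSpace ℂ H₁] [CompleteSpace H₁]
    [NormedAddCommGroup H₂] [InnerProductSpace ℂ H₂] [CompleteSpace H₂]
    (E₁ : SpectralMeasure (EuclideanSpace ℝ (Fin d)) H₁)
    (E₂ : SpectralMeasure (EuclideanSpace ℝ (Fin d)) H₂) (W : H₁ →L[ℂ] H₂) :
    (HasFinitePropagation E₁ E₂ W →
      IsAnalyticMorphism E₁ E₂ W ∧ ExtendsHolomorphicallyTo E₁ E₂ W Set.univ) ∧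
    (IsAnalyticMorphism E₁ E₂ W → IsSmoothMorphism E₁ E₂ W) ∧
    (IsSmoothMorphism E₁ E₂ W → IsUniformMorphism E₁ E₂ W) :=
  ⟨fun h => ⟨h.isAnalyticMorphism, h.extendsHolomorphicallyTo_univ⟩,
    fun h => h.isSmoothMorphism, fun h => ContDiff.continuous h⟩
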